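/- \textbf{Definitions.} A \emph{foliage tree} $\mathbf F$ on a topological space $X$ is a (set-theoretic) tree $T$, i.e. a strict partial order in which the set of predecessors of every node is well-ordered, together with a set $\mathbf F_x\subseteq X$ (the leaf at $x$) for each node $x\in T$. Let $\mathrm{sons}(x)$ denote the set of immediate successors of $x$. A \emph{$\pi$-tree} on $X$ is a foliage tree $\mathbf F$ on $X$ such that (i) $T$ is isomorphic to the tree $({}^{<\omega}\omega,\subset)$ of finite sequences of natural numbers ordered by proper extension; (ii) every leaf $\mathbf F_x$ is open in $X$, and the leaf at the least node is $X$; (iii) for every node $x$ (no node is maximal, by (i)), $\mathbf F_x$ is the union of the sets $\mathbf F_s$, $s\in\mathrm{sons}(x)$, and these sets are pairwise disjoint; (iv) for every branch (maximal chain) $B$ of $T$, the set $\bigcap_{x\in B}\mathbf F_x$ is a singleton; (v) for every $p\in X$ and every neighbourhood $U$ of $p$ there are a node $z$ with $p\in\mathbf F_z$ and a cofinite set $C\subseteq\mathrm{sons}(z)$ such that $\varnothing\neq\bigcup_{s\in C}\mathbf F_s\subseteq U$. The \emph{Baire space} $\mathcal N$ is ${}^{\omega}\omega$ with the product topology, where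 $\omega$ is discrete. The \emph{Sorgenfrey line} $\mathcal R_{\mathcal S}$ is $\mathbb R$ with the topology generated by the half-open intervals $[a,b)$. \textbf{Corollary.} Let $A$ be a set with $1\le|A|\le\omega$ and for each $\alpha\in A$ let $X_\alpha$ be a topological space that is (up to homeomorphism) either the Baire space $\mathcal N$, or a subspace of the Sorgenfrey line $\mathcal R_{\mathcal S}$ whose complement $\mathcal R_{\mathcal S}\setminus X_\alpha$ is at most countable. Then the product space $\prod_{\alpha\in A}X_\alpha$ has a $\pi$-tree. -/

import Mathlib

open Set Topology

namespace PiTree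

universe u

/-- `γ` π-refines `δ`: every nonempty member of `δ` contains a nonempty member of `γ`. -/
def PiRefines {X : Type u} (γ δ : Set (Set X)) : Prop :=
  ∀ D ∈ δ, D.Nonempty → ∃ G ∈ γ, G.Nonempty ∧ G ⊆ D

/-- A foliage tree with leaves in `X`: a set-theoretic tree (a partial order in which the set of
strict predecessors of every node is well-ordered) together with a leaf `leaf x ⊆ X` at each
node `x`. The nodes form a small type; the trees considered below are countable. -/
structure FoliageTree (X : Type u) where
  Node : Type
  order : PartialOrder Node
  wellOrdered : ∀ x : Node, IsWellOrder {v : Node // v < x} (fun v w => v.1 < w.1)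
  leaf : Node → Set X

attribute [instance] FoliageTree.order

namespace FoliageTree

variable {X : Type u} (F : FoliageTree X)

/-- The sons of a node are its immediate successors. -/
def sons (x : F.Node) : Set F.Node :=
  {s | x < s ∧ Ioi x ∩ Iio s = ∅}

/-- The union of the leaves at the nodes in `C`. -/
def flesh (C : Set F.Node) : Set X :=
  ⋃ x ∈ C, F.leaf x

/-- The fleshes of the cofinite sets of sons of `v`. -/
def shoot (v : F.Node) : Set (Set X) :=
  {G | ∃ C : Set F.Node, C ⊆ F.sons v ∧ (F.sons v \ C).Finite ∧ G = F.flesh C}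

/-- The nodes whose leaves contain the point `a`. -/
def scope (a : X) : Set F.Node :=
  {x | a ∈ F.leaf x}

/-- There are nodes, and the leaves along every branch (maximal chain) have exactly one
common point. -/
def HasStrictBranches : Prop :=
  Nonempty F.Node ∧
    ∀ B : Set F.Node, IsMaxChain (· ≤ ·) B → ∃ p : X, ⋂ x ∈ B, F.leaf x = {p}

/-- The leaf at every non-maximal node is the disjoint union of the leaves at its sons. -/
def IsLocallyStrict : Prop :=
  ∀ x : F.Node, ¬ IsMax x →
    F.leaf x = ⋃ s ∈ F.sons x, F.leaf s ∧ (F.sons x).PairwiseDisjoint F.leaf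

/-- The skeleton is isomorphic to the tree of all finite sequences of natural numbers,
strictly ordered by proper extension. -/
def IsOmegaOmegaTree : Prop :=
  Nonempty (((· < ·) : F.Node → F.Node → Prop) ≃r (fun s t : List ℕ => s <+: t ∧ s ≠ t))

variable [TopologicalSpace X]

/-- All leaves are open. -/
def IsOpenTree : Prop :=
  ∀ z : F.Node, IsOpen (F.leaf z)

/-- An open, locally strict foliage `ω,ω`-tree with strict branches, whose leaf at the least node
is the whole space. -/
structure IsBaireFoliageTree : Prop where
  isOpenTree : F.IsOpenTree
  isLocallyStrict : F.IsLocallyStrict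
  isOmegaOmegaTree : F.IsOmegaOmegaTree
  hasStrictBranches : F.HasStrictBranches
  leaf_least : ∃ r : F.Node, IsBot r ∧ F.leaf r = univ

def GrowsInto : Prop :=
  ∀ p : X, ∀ U ∈ 𝓝 p, ∃ z ∈ F.scope p, PiRefines (F.shoot z) {U}

def IsPiTree : Prop :=
  F.IsBaireFoliageTree ∧ F.GrowsInto

end FoliageTree

/-- The space `X` has a π-tree. -/
def HasPiTree (X : Type u) [TopologicalSpace X] : Prop :=
  ∃ F : FoliageTree X, F.IsPiTree

/-- The Sorgenfrey line: the real line with the topology generated by the half-open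
intervals `[a, b)`. -/
def SorgenfreyLine : Type := ℝ

instance : TopologicalSpace SorgenfreyLine :=
  TopologicalSpace.generateFrom {s : Set ℝ | ∃ a b : ℝ, s = Ico a b}

end PiTree

namespace PiTree

open Filter

/-! ### Codes by sequences of pairs -/

/-! A continuous bijection from `X` onto the Baire space makes the preimages of cylinders an open
foliage tree with strict branches (`codeTree`). What remains is growth: near `p`, fixing a prefix of
the code of `p` and making the next entry large must force a point into `U`.

This condition does not pass to products as it stands, so `IsPairCode` strengthens it: the code
consists of pairs, only the first entry has to be large, and every sufficiently late position works.
In a product, finitely many coordinates of the factors are merged at each stage into one pair whose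
first entry is the minimum of theirs, so a large entry makes all of them large. The second entry is
the room that makes this merging a bijection (`HasPairCode.pi`). Interleaving turns pairs into
numbers (`HasPairCode.hasPiTree`).

For a co-countable subspace of the Sorgenfrey line the code comes from nested half-open intervals
that omit the missing points one by one and, at each level, accumulate only at right endpoints as
the first index grows (`exists_isSplitting`, `hasPairCode_of_countable_compl_range`). -/

/-- `φ` identifies the points of `X` with sequences of pairs of natural numbers so that, for `n`
large, the points that share the first `n` pairs of `p` and have a large first entry in the next
pair lie in a prescribed neighbourhood of `p`. -/
structure IsPairCode {X : Type*} [TopologicalSpace X] (φ : X ≃ (ℕ → ℕ × ℕ)) : Prop where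
  continuous : Continuous φ
  grows : ∀ p, ∀ U ∈ 𝓝 p, ∃ N, ∀ n ≥ N, ∃ K, ∀ x, (∀ i < n, φ x i = φ p i) →
    K ≤ (φ x n).1 → x ∈ U

/-- The space `X` has a code by sequences of pairs. -/
def HasPairCode (X : Type*) [TopologicalSpace X] : Prop :=
  ∃ φ : X ≃ (ℕ → ℕ × ℕ), IsPairCode φ

theorem HasPairCode.of_homeomorph {X Y : Type*} [TopologicalSpace X] [TopologicalSpace Y]
    (h : X ≃ₜ Y) (hY : HasPairCode Y) : HasPairCode X := by
  obtain ⟨φ, hφ⟩ := hY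
  refine ⟨h.toEquiv.trans φ, hφ.continuous.comp h.continuous, fun p U hU => ?_⟩
  have hU' : h.symm ⁻¹' U ∈ 𝓝 (h p) :=
    h.symm.continuous.continuousAt.preimage_mem_nhds (by simpa using hU)
  obtain ⟨N, hN⟩ := hφ.grows (h p) _ hU'
  refine ⟨N, fun n hn => ?_⟩
  obtain ⟨K, hK⟩ := hN n hn
  exact ⟨K, fun x hx hx' => by simpa using hK (h x) hx hx'⟩

theorem hasPairCode_baire : HasPairCode (ℕ → ℕ) := by
  refine ⟨Equiv.arrowCongr (Equiv.refl ℕ) Nat.pairEquiv.symm, ?_, fun p U hU => ?_⟩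
  · refine continuous_pi fun n => ?_
    exact (continuous_of_discreteTopology (f := Nat.pairEquiv.symm)).comp (continuous_apply n)
  · obtain ⟨V, hVU, hV, hpV⟩ := mem_nhds_iff.1 hU
    obtain ⟨_, ⟨q, N, rfl⟩, hpq, hqV⟩ :=
      (PiNat.isTopologicalBasis_cylinders fun _ => ℕ).exists_subset_of_mem_open hpV hV
    rw [← PiNat.mem_cylinder_iff_eq.1 hpq] at hqV
    replace hN := hqV.trans hVU
    -- The prefix alone already forces membership, so the bound on the next entry is vacuous.
    refine ⟨N, fun n hn => ⟨0, fun x hx _ => hN fun i hi => ?_⟩⟩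
    exact Nat.pairEquiv.symm.injective (hx i (hi.trans_le hn))

/-! ### The tree of finite sequences -/

/-- Finite sequences, with the last entry at the head, ordered by extension. -/
@[reducible] def suffixOrder : PartialOrder (List ℕ) where
  le s t := s <:+ t
  lt s t := s <:+ t ∧ s ≠ t
  lt_iff_le_not_ge _ _ := and_congr_right fun h =>
    not_congr ⟨fun e => e ▸ List.suffix_refl _,
      fun h' => h.eq_of_length (le_antisymm h.length_le h'.length_le)⟩
  le_refl := List.suffix_refl
  le_trans _ _ _ := List.IsSuffix.trans
  le_antisymm _ _ h h' := h.eq_of_length (le_antisymm h.length_le h'.length_le)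

/-- By maximality, a sequence comparable with every member of `B` lies in `B`. Hence `B` is closed
under suffixes and has no longest member, so it has exactly one member of each length. -/
theorem exists_res_of_isMaxChain {B : Set (List ℕ)} (hB : IsMaxChain (· <:+ ·) B) :
    ∃ y : ℕ → ℕ, B = range fun n => PiNat.res y n := by
  have htot : ∀ s ∈ B, ∀ t ∈ B, s <:+ t ∨ t <:+ s := fun s hs t ht => by
    by_cases h : s = t
    · exact Or.inl (h ▸ List.suffix_refl _)
    · exact hB.1 hs ht h
  have hmem : ∀ s : List ℕ, (∀ t ∈ B, s <:+ t ∨ t <:+ s) → s ∈ B := fun s hs => by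
    rw [hB.2 (hB.1.insert fun t ht _ => hs t ht) (subset_insert s B)]
    exact mem_insert _ _
  have hsuf : ∀ s ∈ B, ∀ t : List ℕ, t <:+ s → t ∈ B := fun s hs t hts =>
    hmem t fun r hr => (htot s hs r hr).elim (fun h => Or.inl (hts.trans h))
      (fun h => List.suffix_or_suffix_of_suffix hts h)
  have hle : ∀ s ∈ B, ∀ t ∈ B, s.length ≤ t.length → s <:+ t := fun s hs t ht hst =>
    (htot s hs t ht).elim id fun h =>
      (h.eq_of_length (le_antisymm h.length_le hst)) ▸ List.suffix_refl _
  have hlong : ∀ n : ℕ, ∃ s ∈ B, n ≤ s.length := by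
    intro n
    induction n with
    | zero => exact ⟨[], hmem _ fun t _ => Or.inl List.nil_suffix, le_rfl⟩
    | succ n ih =>
      obtain ⟨s, hs, hn⟩ := ih
      by_contra! hcon
      have h0 : 0 :: s ∈ B := hmem _ fun t ht =>
        Or.inr ((hle t ht s hs (by have := hcon t ht; omega)).trans (List.suffix_cons 0 s))
      have := hcon _ h0
      rw [List.length_cons] at this
      omega
  have hex : ∀ n : ℕ, ∃ s ∈ B, s.length = n := by
    intro n
    obtain ⟨s, hs, hn⟩ := hlong n
    exact ⟨s.drop (s.length - n), hsuf s hs _ (List.drop_suffix _ _), by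
      rw [List.length_drop]; omega⟩
  choose f hf hfl using hex
  have hy : ∀ n, ∃ c : ℕ, f (n + 1) = c :: f n := by
    intro n
    obtain ⟨l, hl⟩ := hle _ (hf n) _ (hf (n + 1)) (by rw [hfl, hfl]; omega)
    have := congrArg List.length hl
    rw [List.length_append, hfl, hfl] at this
    obtain ⟨c, rfl⟩ := List.length_eq_one_iff.1 (show l.length = 1 by omega)
    exact ⟨c, hl.symm⟩
  choose y hy using hy
  have hfy : ∀ n, f n = PiNat.res y n := by
    intro n
    induction n with
    | zero => exact List.length_eq_zero_iff.1 (hfl 0)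
    | succ n ih => rw [hy, ih]; rfl
  refine ⟨y, Subset.antisymm (fun s hs => ⟨s.length, ?_⟩) ?_⟩
  · have := hle _ (hf s.length) s hs (by rw [hfl])
    exact (hfy _).symm.trans (this.eq_of_length (hfl _))
  · rintro _ ⟨n, rfl⟩
    exact (hfy n).subst (motive := (· ∈ B)) (hf n)

/-- The foliage tree of a coding of points by sequences: the leaf at a finite sequence is the set of
points whose code extends it. -/
def codeTree {X : Type*} (ψ : X → ℕ → ℕ) : FoliageTree X where
  Node := List ℕ
  order := suffixOrder
  wellOrdered x :=
    { wf := Subrelation.wf (fun {v w} (h : v.1 <:+ w.1 ∧ v.1 ≠ w.1) =>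
          h.1.length_le.lt_of_ne fun e => h.2 (h.1.eq_of_length e))
        (measure fun v : {v : List ℕ // v <:+ x ∧ v ≠ x} => v.1.length).wf
      trichotomous := fun v w hvw hwv => by
        by_contra hne
        rcases List.suffix_or_suffix_of_suffix v.2.1 w.2.1 with h | h
        · exact hvw ⟨h, fun e => hne (Subtype.ext e)⟩
        · exact hwv ⟨h, fun e => hne (Subtype.ext e.symm)⟩ }
  leaf s := {x | PiNat.res (ψ x) s.length = s}

section codeTree

variable {X : Type*} (ψ : X → ℕ → ℕ)

theorem codeTree_lt_iff {s t : (codeTree ψ).Node} :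
    s < t ↔ List.IsSuffix (α := ℕ) s t ∧ s ≠ t := Iff.rfl

theorem mem_codeTree_leaf {s : List ℕ} {x : X} :
    x ∈ (codeTree ψ).leaf s ↔ PiNat.res (ψ x) s.length = s := Iff.rfl

theorem codeTree_sons (s : List ℕ) :
    (codeTree ψ).sons s = range fun c : ℕ => (c :: s : List ℕ) := by
  ext t
  constructor
  · rintro ⟨hst, he⟩
    obtain ⟨⟨l, hl⟩, hne⟩ := (codeTree_lt_iff ψ).1 hst
    rcases List.eq_nil_or_concat l with rfl | ⟨l', c, rfl⟩
    · exact absurd hl hne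
    · refine ⟨c, ?_⟩
      have hsuf : List.IsSuffix (c :: s) t := ⟨l', by simpa using hl⟩
      by_contra hct
      have : (c :: s : List ℕ) ∈ (Ioi s ∩ Iio t : Set (codeTree ψ).Node) :=
        ⟨(codeTree_lt_iff ψ).2 ⟨List.suffix_cons c s, fun h => by
          simpa using congrArg List.length h⟩, (codeTree_lt_iff ψ).2 ⟨hsuf, hct⟩⟩
      rw [he] at this
      exact this
  · rintro ⟨c, rfl⟩
    refine ⟨(codeTree_lt_iff ψ).2 ⟨List.suffix_cons c s, fun h => by
      simpa using congrArg List.length h⟩, eq_empty_of_forall_notMem ?_⟩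
    rintro t ⟨h1, h2⟩
    obtain ⟨h1, h1'⟩ := (codeTree_lt_iff ψ).1 h1
    obtain ⟨h2, h2'⟩ := (codeTree_lt_iff ψ).1 h2
    rcases List.suffix_cons_iff.1 h2 with h | h
    · exact h2' h
    · exact h1' (h1.eq_of_length (le_antisymm h1.length_le h.length_le))

theorem mem_codeTree_leaf_cons {s : List ℕ} {c : ℕ} {x : X} :
    x ∈ (codeTree ψ).leaf (c :: s : List ℕ) ↔
      x ∈ (codeTree ψ).leaf s ∧ ψ x s.length = c := by
  simp only [mem_codeTree_leaf, List.length_cons, PiNat.res_succ, List.cons.injEq]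
  exact and_comm

theorem codeTree_isLocallyStrict : (codeTree ψ).IsLocallyStrict := by
  intro s _
  rw [codeTree_sons ψ s]
  constructor
  · ext x
    rw [mem_iUnion₂]
    constructor
    · exact fun hx => ⟨_, ⟨ψ x (List.length s), rfl⟩, (mem_codeTree_leaf_cons ψ).2 ⟨hx, rfl⟩⟩
    · rintro ⟨_, ⟨c, rfl⟩, hc⟩
      exact ((mem_codeTree_leaf_cons ψ).1 hc).1
  · rintro _ ⟨c, rfl⟩ _ ⟨c', rfl⟩ hne
    refine disjoint_left.2 fun x hx hx' => hne ?_
    have h1 := ((mem_codeTree_leaf_cons ψ).1 hx).2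
    have h2 := ((mem_codeTree_leaf_cons ψ).1 hx').2
    rw [← h1, ← h2]

theorem codeTree_isOmegaOmegaTree : (codeTree ψ).IsOmegaOmegaTree := by
  refine ⟨⟨⟨List.reverse, List.reverse, List.reverse_reverse, List.reverse_reverse⟩, ?_⟩⟩
  intro s t
  rw [codeTree_lt_iff]
  exact and_congr List.reverse_prefix (not_congr List.reverse_inj)

theorem codeTree_hasStrictBranches (hψ : Function.Bijective ψ) :
    (codeTree ψ).HasStrictBranches := by
  refine ⟨⟨([] : List ℕ)⟩, fun B hB => ?_⟩
  obtain ⟨y, rfl⟩ := exists_res_of_isMaxChain (B := B) hB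
  obtain ⟨p, rfl⟩ := hψ.2 y
  refine ⟨p, ?_⟩
  ext x
  have hleaf : ∀ n, x ∈ (codeTree ψ).leaf (PiNat.res (ψ p) n) ↔
      PiNat.res (ψ x) n = PiNat.res (ψ p) n := fun n => by
    rw [mem_codeTree_leaf, PiNat.res_length]
  refine mem_iInter₂.trans ⟨fun h => hψ.1 (funext fun n => ?_), ?_⟩
  · exact PiNat.res_eq_res.1 ((hleaf (n + 1)).1 (h _ ⟨n + 1, rfl⟩)) (Nat.lt_succ_self n)
  · rintro rfl _ ⟨n, rfl⟩
    exact (hleaf n).2 rfl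

theorem codeTree_isOpenTree [TopologicalSpace X] (hψ : Continuous ψ) :
    (codeTree ψ).IsOpenTree := by
  intro s
  have : (codeTree ψ).leaf s = ψ ⁻¹' {y | PiNat.res y (List.length s) = s} := rfl
  rw [this]
  refine IsOpen.preimage hψ (isOpen_iff_mem_nhds.2 fun y hy => ?_)
  filter_upwards [(PiNat.isOpen_cylinder (fun _ : ℕ => ℕ) y (List.length s)).mem_nhds
    (PiNat.self_mem_cylinder y _)] with z hz
  exact (PiNat.res_eq_res.2 fun {i} hi => hz i hi).trans hy

theorem codeTree_isBaireFoliageTree [TopologicalSpace X] (hψ : Continuous ψ)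
    (hb : Function.Bijective ψ) : (codeTree ψ).IsBaireFoliageTree where
  isOpenTree := codeTree_isOpenTree ψ hψ
  isLocallyStrict := codeTree_isLocallyStrict ψ
  isOmegaOmegaTree := codeTree_isOmegaOmegaTree ψ
  hasStrictBranches := codeTree_hasStrictBranches ψ hb
  leaf_least := ⟨([] : List ℕ), fun _ => List.nil_suffix, eq_univ_of_forall fun _ => rfl⟩

theorem codeTree_growsInto [TopologicalSpace X] (hb : Function.Bijective ψ)
    (h : ∀ p, ∀ U ∈ 𝓝 p, ∃ n K, ∀ x, (∀ i < n, ψ x i = ψ p i) → K ≤ ψ x n → x ∈ U) :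
    (codeTree ψ).GrowsInto := by
  intro p U hU
  obtain ⟨n, K, hK⟩ := h p U hU
  refine ⟨PiNat.res (ψ p) n, by
    show PiNat.res (ψ p) (PiNat.res (ψ p) n).length = _
    rw [PiNat.res_length], ?_⟩
  rintro _ rfl -
  set z : List ℕ := PiNat.res (ψ p) n with hz
  refine ⟨_, ⟨(fun c : ℕ => (c :: z : List ℕ)) '' Ici K, ?_, ?_, rfl⟩, ?_, ?_⟩
  · rw [codeTree_sons]
    exact image_subset_range _ _
  · rw [codeTree_sons]
    refine ((finite_Iio K).image fun c : ℕ => (c :: z : List ℕ)).subset ?_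
    rintro _ ⟨⟨c, rfl⟩, hc⟩
    exact ⟨c, mem_Iio.2 (not_le.1 fun h => hc ⟨c, h, rfl⟩), rfl⟩
  -- Nonemptiness of the flesh: surjectivity realizes the code of `p` with entry `n` changed to `K`.
  · obtain ⟨x, hx⟩ := hb.2 (Function.update (ψ p) n K)
    refine ⟨x, mem_biUnion (mem_image_of_mem _ (self_mem_Ici (a := K)))
      ((mem_codeTree_leaf_cons ψ).2 ⟨?_, ?_⟩)⟩
    · rw [mem_codeTree_leaf, hz, PiNat.res_length, PiNat.res_eq_res]
      intro i hi
      rw [hx, Function.update_of_ne hi.ne]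
    · rw [hx, hz, PiNat.res_length, Function.update_self]
  · refine iUnion₂_subset ?_
    rintro _ ⟨c, hc, rfl⟩ x hx
    obtain ⟨h1, h2⟩ := (mem_codeTree_leaf_cons ψ).1 hx
    rw [mem_codeTree_leaf, hz, PiNat.res_length, PiNat.res_eq_res] at h1
    rw [hz, PiNat.res_length] at h2
    exact hK x (fun i hi => h1 hi) (h2 ▸ hc)

end codeTree

/-- Sequences of pairs, interleaved into sequences of numbers. -/
def interleave : (ℕ → ℕ × ℕ) ≃ (ℕ → ℕ) :=
  (Equiv.arrowProdEquivProdArrow ℕ (fun _ => ℕ) (fun _ => ℕ)).trans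
    ((Equiv.sumArrowEquivProdArrow ℕ ℕ ℕ).symm.trans
      (Equiv.arrowCongr Equiv.natSumNatEquivNat (Equiv.refl ℕ)))

theorem interleave_two_mul (y : ℕ → ℕ × ℕ) (n : ℕ) : interleave y (2 * n) = (y n).1 := by
  have : Equiv.natSumNatEquivNat.symm (2 * n) = Sum.inl n := by
    rw [Equiv.symm_apply_eq]; simp
  simp [interleave, this]

theorem interleave_two_mul_add_one (y : ℕ → ℕ × ℕ) (n : ℕ) :
    interleave y (2 * n + 1) = (y n).2 := by
  have : Equiv.natSumNatEquivNat.symm (2 * n + 1) = Sum.inr n := by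
    rw [Equiv.symm_apply_eq]; simp
  simp [interleave, this]

theorem continuous_interleave : Continuous interleave := by
  refine continuous_pi fun n => ?_
  rcases Nat.even_or_odd' n with ⟨k, rfl | rfl⟩
  · simp only [interleave_two_mul]; fun_prop
  · simp only [interleave_two_mul_add_one]; fun_prop

theorem HasPairCode.hasPiTree {X : Type*} [TopologicalSpace X] (h : HasPairCode X) :
    HasPiTree X := by
  obtain ⟨φ, hφ⟩ := h
  have hb := (φ.trans interleave).bijective
  refine ⟨codeTree (φ.trans interleave), codeTree_isBaireFoliageTree _
    (continuous_interleave.comp hφ.continuous) hb, codeTree_growsInto _ hb fun p U hU => ?_⟩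
  obtain ⟨N, hN⟩ := hφ.grows p U hU
  obtain ⟨K, hK⟩ := hN N le_rfl
  -- Position `2 * N` holds the first entry of pair `N`; the earlier positions hold exactly the
  -- first `N` pairs.
  refine ⟨2 * N, K, fun x hx hx' => hK x (fun i hi => ?_) ?_⟩
  · have h0 := hx (2 * i) (by omega)
    have h1 := hx (2 * i + 1) (by omega)
    simp only [Equiv.trans_apply, interleave_two_mul, interleave_two_mul_add_one] at h0 h1
    exact Prod.ext h0 h1
  · simpa only [Equiv.trans_apply, interleave_two_mul] using hx'

/-! ### Products -/

/-- A countable set with a map to `ℕ` whose fibres are all infinite is a copy of `ℕ × ℕ` over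
`ℕ`. -/
theorem exists_equiv_prod_of_infinite_fibers {B : Type*} [Countable B] (f : B → ℕ)
    (hf : ∀ m, Infinite {b // f b = m}) : ∃ e : B ≃ ℕ × ℕ, ∀ b, (e b).1 = f b := by
  have (m : ℕ) : Nonempty ({b // f b = m} ≃ ℕ) := nonempty_equiv_of_countable
  exact ⟨(Equiv.sigmaFiberEquiv f).symm.trans ((Equiv.sigmaCongrRight fun m =>
    (this m).some).trans (Equiv.sigmaEquivProd ℕ ℕ)), fun b => rfl⟩

/-- Coordinate `i` of factor `α` is used at stage `max (k α) i`. Once `n` exceeds `k α`, stage `n`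
reads coordinate `n` of that factor and the earlier stages contain all its coordinates below `n`, so
the growth conditions of finitely many factors apply simultaneously. -/
theorem HasPairCode.pi {A : Type*} [Nonempty A] [Countable A] {X : A → Type*}
    [∀ α, TopologicalSpace (X α)] (h : ∀ α, HasPairCode (X α)) : HasPairCode (∀ α, X α) := by
  choose φ hφ using h
  obtain ⟨ι, hι⟩ := Countable.exists_injective_nat A
  obtain ⟨α₀⟩ := ‹Nonempty A›
  -- The truncated shift gives `k α₀ = 0`, so `(α₀, n)` makes stage `n` nonempty, while `k` stays
  -- finite-to-one.
  let k : A → ℕ := fun α => ι α - ι α₀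
  have hk : ∀ n, {α | k α ≤ n}.Finite := fun n =>
    ((finite_Iic (n + ι α₀)).preimage hι.injOn).subset fun α (hα : ι α - ι α₀ ≤ n) => by
      simp only [mem_preimage, mem_Iic]; omega
  let st : A × ℕ → ℕ := fun q => max (k q.1) q.2
  have hfin : ∀ n, Finite {q // st q = n} := fun n =>
    (((hk n).prod (finite_Iic n)).subset fun q (hq : st q = n) =>
      ⟨(le_max_left _ _).trans hq.le, (le_max_right _ _).trans hq.le⟩).to_subtype
  have hne : ∀ n, Nonempty {q // st q = n} := fun n => ⟨⟨(α₀, n), by simp [st, k]⟩⟩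
  have he : ∀ n, ∃ e : ({q // st q = n} → ℕ × ℕ) ≃ ℕ × ℕ, ∀ b, (e b).1 = ⨅ q, (b q).1 := by
    intro n
    refine exists_equiv_prod_of_infinite_fibers _ fun m => ?_
    -- The constant families `(m, j)`, with `j` varying, all have minimum `m`.
    refine Infinite.of_injective
      (fun j : ℕ => (⟨fun _ => (m, j), ciInf_const⟩ :
        {b : {q // st q = n} → ℕ × ℕ // ⨅ q, (b q).1 = m})) fun j j' hj => ?_
    obtain ⟨q⟩ := hne n
    exact congrArg Prod.snd (congrFun (congrArg Subtype.val hj) q)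
  choose e he using he
  let Φ : (∀ α, X α) ≃ (ℕ → ℕ × ℕ) :=
    (Equiv.piCongrRight φ).trans ((Equiv.curry A ℕ (ℕ × ℕ)).symm.trans
      ((Equiv.arrowCongr (Equiv.sigmaFiberEquiv st).symm (Equiv.refl (ℕ × ℕ))).trans
        ((Equiv.piCurry fun _ _ => ℕ × ℕ).trans (Equiv.piCongrRight e))))
  have hΦ : ∀ x n, Φ x n = e n fun q => φ q.1.1 (x q.1.1) q.1.2 := fun _ _ => rfl
  refine ⟨Φ, continuous_pi fun n => ?_, fun p U hU => ?_⟩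
  · simp only [hΦ]
    refine (continuous_of_discreteTopology (f := e n)).comp (continuous_pi fun q => ?_)
    exact (continuous_apply q.1.2).comp ((hφ q.1.1).continuous.comp (continuous_apply q.1.1))
  · rw [nhds_pi, Filter.mem_pi] at hU
    obtain ⟨F, hF, V, hV, hVU⟩ := hU
    choose N hN using fun α => (hφ α).grows (p α) (V α) (hV α)
    obtain ⟨M, hM⟩ := (hF.image fun α => max (N α) (k α + 1)).bddAbove
    refine ⟨M, fun n hn => ?_⟩
    have hn' : ∀ α ∈ F, N α ≤ n ∧ k α < n := fun α hα =>
      max_le_iff.1 ((hM (mem_image_of_mem _ hα)).trans hn)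
    choose! K hK using fun α (hα : α ∈ F) => hN α n (hn' α hα).1
    obtain ⟨K', hK'⟩ := (hF.image K).bddAbove
    refine ⟨K', fun x hx hxn => hVU fun α hα => hK α hα (x α) (fun i hi => ?_) ?_⟩
    · have hst : st (α, i) < n := max_lt (hn' α hα).2 hi
      have := hx _ hst
      rw [hΦ, hΦ, (e _).apply_eq_iff_eq] at this
      exact congrFun this ⟨(α, i), rfl⟩
    · have hst : st (α, n) = n := max_eq_right (hn' α hα).2.le
      rw [hΦ, he] at hxn
      let q : {q // st q = n} := ⟨(α, n), hst⟩
      exact (hK' (mem_image_of_mem K hα)).trans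
        (hxn.trans (ciInf_le (OrderBot.bddBelow _) q))

/-! ### Codes from schemes of open sets -/

/-- Following the unique child containing `x` reads off its code; `hbr` makes the coding bijective.
-/
theorem exists_equiv_of_scheme {X C : Type*} (L : List C → Set X) (h0 : L [] = univ)
    (hsub : ∀ l c, L (c :: l) ⊆ L l) (hex : ∀ l, ∀ x ∈ L l, ∃! c, x ∈ L (c :: l))
    (hbr : ∀ y : ℕ → C, ∃! x, ∀ n, x ∈ L (PiNat.res y n)) :
    ∃ φ : X ≃ (ℕ → C), ∀ x y n, x ∈ L (PiNat.res y n) ↔ PiNat.res (φ x) n = PiNat.res y n := by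
  have hcode : ∀ x, ∃ y : ℕ → C, ∀ n, x ∈ L (PiNat.res y n) := by
    intro x
    have : Nonempty C := (hex [] x (h0 ▸ mem_univ x)).exists.nonempty
    choose! next hnext _ using fun l (hl : x ∈ L l) => hex l x hl
    let r : ℕ → List C := fun n => Nat.rec [] (fun _ l => next l :: l) n
    have hr : ∀ n, x ∈ L (r n) := fun n => by
      induction n with
      | zero => exact h0 ▸ mem_univ x
      | succ n ih => exact hnext _ ih
    refine ⟨fun n => next (r n), fun n => ?_⟩
    have : PiNat.res (fun n => next (r n)) n = r n := by
      induction n with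
      | zero => rfl
      | succ n ih => rw [PiNat.res_succ, ih]
    exact this ▸ hr n
  choose g hg using hcode
  have key : ∀ x y n, x ∈ L (PiNat.res y n) → PiNat.res (g x) n = PiNat.res y n := by
    intro x y n
    induction n with
    | zero => exact fun _ => rfl
    | succ n ih =>
      intro hx
      have hn := ih (hsub _ _ hx)
      have h1 := hg x (n + 1)
      rw [PiNat.res_succ] at hx h1 ⊢
      rw [hn] at h1 ⊢
      rw [(hex _ x (hsub _ _ hx)).unique h1 hx, PiNat.res_succ]
  have hb : Function.Bijective g := by
    constructor
    · intro x x' hxx'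
      exact (hbr (g x)).unique (hg x) (hxx' ▸ hg x')
    · intro y
      obtain ⟨x, hx, _⟩ := hbr y
      exact ⟨x, PiNat.res_injective (funext fun n => key x y n (hx n))⟩
  exact ⟨Equiv.ofBijective g hb, fun x y n => ⟨key x y n, fun h => h ▸ hg x n⟩⟩

/-! ### Partitions into half-open intervals -/

/-- The intervals `[(Q i).1, (Q i).2)` are nonempty and partition `O`. -/
structure IsIcoPartition {ι : Type*} (O : Set ℝ) (Q : ι → ℝ × ℝ) : Prop where
  lt : ∀ i, (Q i).1 < (Q i).2
  subset : ∀ i, Ico (Q i).1 (Q i).2 ⊆ O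
  existsUnique : ∀ x ∈ O, ∃! i, x ∈ Ico (Q i).1 (Q i).2

theorem IsIcoPartition.comp_equiv {ι κ : Type*} {O : Set ℝ} {Q : ι → ℝ × ℝ}
    (hQ : IsIcoPartition O Q) (e : κ ≃ ι) : IsIcoPartition O (Q ∘ e) where
  lt _ := hQ.lt _
  subset _ := hQ.subset _
  existsUnique x hx := (e.existsUnique_congr_left (p := fun k =>
    x ∈ Ico ((Q ∘ e) k).1 ((Q ∘ e) k).2)).2 (by simpa using hQ.existsUnique x hx)

theorem IsIcoPartition.bind {ι κ : Type*} {O E : Set ℝ} {Q : ι → ℝ × ℝ}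
    {R : ι → κ → ℝ × ℝ} (hQ : IsIcoPartition O Q)
    (hR : ∀ i, IsIcoPartition (Ico (Q i).1 (Q i).2 \ E) (R i)) :
    IsIcoPartition (O \ E) (fun p : ι × κ => R p.1 p.2) where
  lt p := (hR p.1).lt p.2
  subset p := ((hR p.1).subset p.2).trans (sdiff_subset_sdiff_left (hQ.subset p.1))
  existsUnique x hx := by
    obtain ⟨i, hi, hi'⟩ := hQ.existsUnique x hx.1
    obtain ⟨j, hj, hj'⟩ := (hR i).existsUnique x ⟨hi, hx.2⟩
    refine ⟨(i, j), hj, fun p hp => ?_⟩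
    obtain rfl := hi' p.1 ((hR p.1).subset p.2 hp).1
    exact Prod.ext rfl (hj' p.2 hp)

theorem isIcoPartition_of_strictMono {t : ℕ → ℝ} {v : ℝ} (ht : StrictMono t)
    (hv : Tendsto t atTop (𝓝 v)) :
    IsIcoPartition (Ico (t 0) v) fun j => (t j, t (j + 1)) where
  lt j := ht (Nat.lt_succ_self j)
  subset j := Ico_subset_Ico (ht.monotone (Nat.zero_le j)) (ht.monotone.ge_of_tendsto hv _)
  existsUnique x hx := by
    have hex : ∃ n, x < t n := (hv.eventually (lt_mem_nhds hx.2)).exists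
    obtain ⟨j, hj⟩ : ∃ j, Nat.find hex = j + 1 := Nat.exists_eq_succ_of_ne_zero fun h =>
      (Nat.find_spec hex).not_ge (h ▸ hx.1)
    have hxj : x ∈ Ico (t j) (t (j + 1)) :=
      ⟨not_lt.1 (Nat.find_min hex (by omega)), hj ▸ Nat.find_spec hex⟩
    refine ⟨j, hxj, fun i hi => ?_⟩
    by_contra hne
    exact disjoint_left.1 (ht.monotone.pairwise_disjoint_on_Ico_succ hne) hi hxj

theorem isIcoPartition_of_strictAnti {t : ℕ → ℝ} {d : ℝ} (ht : StrictAnti t)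
    (hd : Tendsto t atTop (𝓝 d)) :
    IsIcoPartition (Ioo d (t 0)) fun j => (t (j + 1), t j) where
  lt j := ht (Nat.lt_succ_self j)
  subset j x hx := ⟨(ht.antitone.le_of_tendsto hd (j + 2)).trans_lt
    ((ht (Nat.lt_succ_self (j + 1))).trans_le hx.1), hx.2.trans_le (ht.antitone (Nat.zero_le j))⟩
  existsUnique x hx := by
    have hex : ∃ n, t n ≤ x :=
      ((hd.eventually (gt_mem_nhds hx.1)).exists).imp fun _ h => h.le
    obtain ⟨j, hj⟩ : ∃ j, Nat.find hex = j + 1 := Nat.exists_eq_succ_of_ne_zero fun h =>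
      hx.2.not_ge (h ▸ Nat.find_spec hex)
    have hxj : x ∈ Ico (t (j + 1)) (t j) :=
      ⟨hj ▸ Nat.find_spec hex, not_le.1 (Nat.find_min hex (by omega))⟩
    refine ⟨j, hxj, fun i hi => ?_⟩
    by_contra hne
    exact disjoint_left.1 (ht.antitone.pairwise_disjoint_on_Ico_succ hne) hi hxj

theorem tendsto_add_mul_half_pow (a w : ℝ) :
    Tendsto (fun n : ℕ => a + w * (1 / 2) ^ n) atTop (𝓝 a) := by
  simpa using ((tendsto_pow_atTop_nhds_zero_of_lt_one (r := (1 / 2 : ℝ)) (by norm_num)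
    (by norm_num)).const_mul w).const_add a

/-- Cut at the points `v - (v - u) / 2 ^ n`; the first piece is the longest, with half the length.
-/
theorem exists_isIcoPartition_ascending {u v : ℝ} (h : u < v) :
    ∃ Q : ℕ → ℝ × ℝ, IsIcoPartition (Ico u v) Q ∧ (∀ j, (Q j).2 < v) ∧
      (∀ j, (Q j).2 - (Q j).1 ≤ (v - u) / 2) ∧ ∀ x < v, ∃ K, ∀ j ≥ K, x ≤ (Q j).1 := by
  let t : ℕ → ℝ := fun n => v + (u - v) * (1 / 2) ^ n
  have hpow : ∀ n : ℕ, (0 : ℝ) < (1 / 2) ^ n := fun n => by positivity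
  have ht : StrictMono t := strictMono_nat_of_lt_succ fun n => by
    simp only [t, pow_succ]
    nlinarith [mul_pos (sub_pos.2 h) (hpow n)]
  have htv : Tendsto t atTop (𝓝 v) := tendsto_add_mul_half_pow v (u - v)
  have ht0 : t 0 = u := by simp [t]
  refine ⟨_, ht0 ▸ isIcoPartition_of_strictMono ht htv, fun j => ?_, fun j => ?_, fun x hx => ?_⟩
  · exact (ht (Nat.lt_succ_self (j + 1))).trans_le (ht.monotone.ge_of_tendsto htv _)
  · simp only [t, pow_succ]
    have : ((1 : ℝ) / 2) ^ j ≤ 1 := pow_le_one₀ (by norm_num) (by norm_num)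
    nlinarith [mul_le_mul_of_nonneg_left this (sub_pos.2 h).le]
  · exact eventually_atTop.1 ((htv.eventually (lt_mem_nhds hx)).mono fun _ h => h.le)

theorem exists_isIcoPartition_Ioo {d v : ℝ} (h : d < v) :
    ∃ Q : ℕ → ℝ × ℝ, IsIcoPartition (Ioo d v) Q := by
  let t : ℕ → ℝ := fun n => d + (v - d) * (1 / 2) ^ n
  have ht : StrictAnti t := strictAnti_nat_of_succ_lt fun n => by
    simp only [t, pow_succ]
    have : (0 : ℝ) < (1 / 2) ^ n := by positivity
    nlinarith [mul_pos (sub_pos.2 h) this]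
  have ht0 : t 0 = v := by simp [t]
  exact ⟨_, ht0 ▸ isIcoPartition_of_strictAnti ht (tendsto_add_mul_half_pow d (v - d))⟩

/-- If the point `d` of `E` lies in the interval, the part to its right is cut along a sequence
decreasing to `d`, and the part to its left, if any, is one further piece. -/
theorem exists_isIcoPartition_diff {u v : ℝ} (h : u < v) {E : Set ℝ} (hE : E.Subsingleton) :
    ∃ Q : ℕ → ℝ × ℝ, IsIcoPartition (Ico u v \ E) Q := by
  by_cases hd : Disjoint (Ico u v) E
  · rw [hd.sdiff_eq_left]
    obtain ⟨Q, hQ, -⟩ := exists_isIcoPartition_ascending h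
    exact ⟨Q, hQ⟩
  · obtain ⟨d, hdI, hdE⟩ := not_disjoint_iff.1 hd
    obtain rfl : E = {d} := hE.eq_singleton_of_mem hdE
    obtain ⟨Q, hQ⟩ := exists_isIcoPartition_Ioo hdI.2
    rcases hdI.1.eq_or_lt with rfl | hud
    · exact ⟨Q, by rwa [Ico_sdiff_left]⟩
    refine ⟨fun n => Nat.casesOn n (u, d) Q, ⟨?_, ?_, ?_⟩⟩
    · rintro (_ | j)
      · exact hud
      · exact hQ.lt j
    · rintro (_ | j) x hx
      · exact ⟨⟨hx.1, hx.2.trans hdI.2⟩, hx.2.ne⟩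
      · obtain ⟨h1, h2⟩ := hQ.subset j hx
        exact ⟨⟨hud.le.trans h1.le, h2⟩, h1.ne'⟩
    · rintro x ⟨hx, hxd⟩
      rcases lt_or_gt_of_ne hxd with hlt | hgt
      · refine ⟨0, ⟨hx.1, hlt⟩, ?_⟩
        rintro (_ | j) hj
        · rfl
        · exact absurd (hQ.subset j hj).1 hlt.not_gt
      · obtain ⟨j, hj, hj'⟩ := hQ.existsUnique x ⟨hgt, hx.2⟩
        refine ⟨j + 1, hj, ?_⟩
        rintro (_ | i) hi
        · exact absurd hi.2 hgt.not_gt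
        · rw [hj' i hi]

/-- A partition of `[u, v)` without the set `E` into short half-open intervals indexed by pairs:
their closures avoid `E` and `v`, and they approach `v` as the first index grows. -/
structure IsSplitting (E : Set ℝ) (p : ℝ × ℝ) (J : ℕ × ℕ → ℝ × ℝ) : Prop
    extends IsIcoPartition (Ico p.1 p.2 \ E) J where
  Icc_subset : ∀ c, Icc (J c).1 (J c).2 ⊆ Ico p.1 p.2 \ E
  length_le : ∀ c, (J c).2 - (J c).1 ≤ (p.2 - p.1) / 2
  approaches : ∀ x < p.2, ∃ K, ∀ c : ℕ × ℕ, K ≤ c.1 → x ≤ (J c).1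

/-- Three successive partitions: `Q` climbs to the right endpoint and supplies the first index, `R`
removes `E`, and `T` climbs inside each piece of `R` so that right endpoints stay strictly inside
it. The last step is what makes the closed intervals avoid `E`. -/
theorem exists_isSplitting {p : ℝ × ℝ} (h : p.1 < p.2) {E : Set ℝ} (hE : E.Subsingleton) :
    ∃ J, IsSplitting E p J := by
  obtain ⟨Q, hQ, -, hQl, hQa⟩ := exists_isIcoPartition_ascending h
  choose R hR using fun k => exists_isIcoPartition_diff (hQ.lt k) hE
  choose T hT hTlt _ _ using fun k l => exists_isIcoPartition_ascending ((hR k).lt l)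
  have hRT : ∀ k, IsIcoPartition (Ico (Q k).1 (Q k).2 \ E)
      fun m : ℕ => T k (Nat.unpair m).1 (Nat.unpair m).2 := fun k => by
    have := ((hR k).bind (E := ∅) (R := T k) fun l => by
      simpa using hT k l).comp_equiv Nat.pairEquiv.symm
    rwa [sdiff_empty] at this
  have hsub : ∀ c : ℕ × ℕ, Icc (T c.1 (Nat.unpair c.2).1 (Nat.unpair c.2).2).1
      (T c.1 (Nat.unpair c.2).1 (Nat.unpair c.2).2).2 ⊆ Ico (Q c.1).1 (Q c.1).2 \ E :=
    fun c x hx => (hR c.1).subset _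
      ⟨((hT c.1 _).subset _ ⟨le_rfl, (hT c.1 _).lt _⟩).1.trans hx.1,
        hx.2.trans_lt (hTlt _ _ _)⟩
  refine ⟨_, hQ.bind hRT, fun c => ?_, fun c => ?_, fun x hx => ?_⟩
  · exact (hsub c).trans (sdiff_subset_sdiff_left (hQ.subset _))
  · have hlt := (hRT c.1).lt c.2
    have h1 := (hsub c ⟨le_rfl, hlt.le⟩).1.1
    have h2 := (hsub c ⟨hlt.le, le_rfl⟩).1.2
    have h3 := hQl c.1
    linarith
  · obtain ⟨K, hK⟩ := hQa x hx
    refine ⟨K, fun c hc => (hK _ hc).trans ?_⟩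
    exact (hsub c ⟨le_rfl, ((hRT c.1).lt c.2).le⟩).1.1

theorem exists_isIcoPartition_univ : ∃ J : ℕ × ℕ → ℝ × ℝ, IsIcoPartition univ J := by
  have e : ℕ × ℕ ≃ ℤ := (nonempty_equiv_of_countable).some
  refine ⟨_, IsIcoPartition.comp_equiv (Q := fun z : ℤ => ((z : ℝ), (z : ℝ) + 1))
    ⟨fun z => lt_add_one _, fun _ => subset_univ _, fun x _ => ?_⟩ e⟩
  exact ⟨⌊x⌋, ⟨Int.floor_le x, Int.lt_floor_add_one x⟩, fun z hz => (Int.floor_eq_iff.2 hz).symm⟩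

/-- The intervals indexed by finite sequences, given a partition of the line and a splitting
operation for intervals. -/
def icoScheme {C : Type*} (J₀ : C → ℝ × ℝ) (J : ℕ → ℝ × ℝ → C → ℝ × ℝ) : List C → ℝ × ℝ
  -- A dummy value: the root stands for the whole line, which is not a bounded interval.
  | [] => (0, 1)
  | [c] => J₀ c
  | c :: c' :: l => J l.length (icoScheme J₀ J (c' :: l)) c

/-! ### Subspaces of the Sorgenfrey line -/

/-- Along a branch the closed intervals are nested, so they share a point; it escapes every `E n`,
hence lies in `range f`, and the halving of lengths makes it unique. For growth, take an interval
around `f p` shorter than `b - f p`: its pieces with large first index lie to the right of `f p` and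
to the left of `b`. -/
theorem hasPairCode_of_countable_compl_range {X : Type*} [TopologicalSpace X] {f : X → ℝ}
    (hf : Function.Injective f) (hc : (range f)ᶜ.Countable)
    (ho : ∀ a b, IsOpen (f ⁻¹' Ico a b))
    (hn : ∀ p, ∀ U ∈ 𝓝 p, ∃ b > f p, f ⁻¹' Ico (f p) b ⊆ U) : HasPairCode X := by
  obtain ⟨d, hd⟩ := countable_iff_exists_subset_range.1 hc
  -- The sequence `d` only covers the complement, so its values inside `range f` must be spared.
  let E : ℕ → Set ℝ := fun n => {d n} \ range f
  have hE : ∀ n, (E n).Subsingleton := fun n => subsingleton_singleton.anti sdiff_subset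
  have hEf : ∀ n x, f x ∉ E n := fun n x h => h.2 (mem_range_self x)
  obtain ⟨J₀, hJ₀⟩ := exists_isIcoPartition_univ
  choose! J hJ using fun n (p : ℝ × ℝ) (h : p.1 < p.2) => exists_isSplitting h (hE n)
  let I := icoScheme J₀ J
  have hI : ∀ l c, (I (c :: l)).1 < (I (c :: l)).2 := by
    intro l
    induction l with
    | nil => exact hJ₀.lt
    | cons c' l ih => exact fun c => (hJ _ _ (ih c')).lt c
  have hJI : ∀ c l, IsSplitting (E l.length) (I (c :: l)) fun c' => I (c' :: c :: l) :=
    fun c l => hJ _ _ (hI l c)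
  let L : List (ℕ × ℕ) → Set X := fun l => {x | l ≠ [] → f x ∈ Ico (I l).1 (I l).2}
  have hL : ∀ l c x, x ∈ L (c :: l) ↔ f x ∈ Ico (I (c :: l)).1 (I (c :: l)).2 :=
    fun l c x => ⟨fun h => h (List.cons_ne_nil _ _), fun h _ => h⟩
  have hL0 : L [] = univ := eq_univ_of_forall fun _ h => absurd rfl h
  have hwidth : ∀ (y : ℕ → ℕ × ℕ) n, (I (PiNat.res y (n + 1))).2 - (I (PiNat.res y (n + 1))).1 ≤
      0 + ((I (PiNat.res y 1)).2 - (I (PiNat.res y 1)).1) * (1 / 2) ^ n := by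
    intro y n
    induction n with
    | zero => simp
    | succ n ih =>
      have := (hJI (y n) (PiNat.res y n)).length_le (y (n + 1))
      rw [pow_succ]
      simp only [PiNat.res_succ] at this ih ⊢
      linarith
  have hopen : ∀ l, IsOpen (L l) := by
    rintro (_ | ⟨c, l⟩)
    · exact hL0 ▸ isOpen_univ
    · have : L (c :: l) = f ⁻¹' Ico (I (c :: l)).1 (I (c :: l)).2 := ext (hL l c)
      exact this ▸ ho _ _
  obtain ⟨φ, hφ⟩ := exists_equiv_of_scheme L hL0
    (by
      rintro (_ | ⟨c', l⟩) c x hx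
      · exact hL0 ▸ mem_univ x
      · rw [hL] at hx ⊢
        exact ((hJI c' l).subset c hx).1)
    (by
      rintro (_ | ⟨c', l⟩) x hx
      · simp only [hL]
        exact hJ₀.existsUnique (f x) (mem_univ _)
      · simp only [hL] at hx ⊢
        exact (hJI c' l).existsUnique (f x) ⟨hx, hEf _ _⟩)
    (by
      intro y
      let P : ℕ → ℝ × ℝ := fun n => I (PiNat.res y (n + 1))
      have hP : ∀ n, Icc (P (n + 1)).1 (P (n + 1)).2 ⊆ Ico (P n).1 (P n).2 \ E n := fun n => by
        have := (hJI (y n) (PiNat.res y n)).Icc_subset (y (n + 1))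
        rwa [PiNat.res_length] at this
      have hPlt : ∀ n, (P n).1 < (P n).2 := fun n => hI _ _
      have hmono : Monotone fun n => (P n).1 := monotone_nat_of_le_succ fun n =>
        (hP n ⟨le_rfl, (hPlt _).le⟩).1.1
      have hanti : Antitone fun n => (P n).2 := antitone_nat_of_succ_le fun n =>
        (hP n ⟨(hPlt _).le, le_rfl⟩).1.2.le
      have ht := hmono.ciSup_mem_iInter_Icc_of_antitone hanti fun n => (hPlt n).le
      set t := ⨆ n, (P n).1
      -- Membership in the closed interval at level `n + 1` gives membership in the half-open one at
      -- level `n`, away from `E n`.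
      have ht' : ∀ n, t ∈ Ico (P n).1 (P n).2 \ E n := fun n => hP n (mem_iInter.1 ht (n + 1))
      obtain ⟨x, hx⟩ : t ∈ range f := by
        by_contra h
        obtain ⟨n, hn⟩ := hd h
        exact (ht' n).2 ⟨hn.symm, h⟩
      refine ⟨x, ?_, fun x' hx' => hf ?_⟩
      · rintro (_ | n)
        · exact hL0 ▸ mem_univ x
        · exact (hL _ _ _).2 (hx ▸ (ht' n).1)
      · rw [hx]
        have hx'' : ∀ n, f x' ∈ Ico (P n).1 (P n).2 := fun n => (hL _ _ _).1 (hx' (n + 1))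
        have hle : |f x' - t| ≤ 0 := ge_of_tendsto' (tendsto_add_mul_half_pow 0 _) fun n => by
          refine le_trans ?_ (hwidth y n)
          have h1 := hx'' n
          have h2 := (ht' n).1
          exact abs_sub_le_iff.2 ⟨by linarith [h1.2, h2.1], by linarith [h1.1, h2.2]⟩
        exact sub_eq_zero.1 (abs_nonpos_iff.1 hle))
  have hmem : ∀ x n, f x ∈ Ico (I (PiNat.res (φ x) (n + 1))).1 (I (PiNat.res (φ x) (n + 1))).2 :=
    fun x n => (hL _ _ _).1 ((hφ x (φ x) (n + 1)).2 rfl)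
  refine ⟨φ, continuous_pi fun n => continuous_discrete_rng.2 fun c => ?_, fun p U hU => ?_⟩
  · refine isOpen_iff_mem_nhds.2 fun x hx => ?_
    filter_upwards [(hopen _).mem_nhds ((hφ x (φ x) (n + 1)).2 rfl)] with x' hx'
    exact (PiNat.res_eq_res.1 ((hφ _ _ _).1 hx') (Nat.lt_succ_self n)).trans hx
  · obtain ⟨b, hb, hbU⟩ := hn p U hU
    obtain ⟨N, hN⟩ := eventually_atTop.1 ((tendsto_add_mul_half_pow 0
      ((I (PiNat.res (φ p) 1)).2 - (I (PiNat.res (φ p) 1)).1)).eventually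
        (gt_mem_nhds (sub_pos.2 hb)))
    -- The shift by one skips the root, whose dummy interval says nothing about `p`.
    refine ⟨N + 1, fun n hn => ?_⟩
    obtain ⟨m, rfl⟩ : ∃ m, n = m + 1 := ⟨n - 1, by omega⟩
    have hw := (hwidth (φ p) m).trans_lt (hN m (by omega))
    have hpm := hmem p m
    have hs := hJI (φ p m) (PiNat.res (φ p) m)
    obtain ⟨K, hK⟩ := hs.approaches (f p) hpm.2
    refine ⟨K, fun x hx hxK => hbU ?_⟩
    have hxm := hmem x (m + 1)
    rw [PiNat.res_succ, PiNat.res_eq_res.2 fun {i} hi => hx i hi] at hxm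
    have h1 := (hs.subset (φ x (m + 1)) hxm).1.2
    have h2 := hK _ hxK
    have h3 := hpm.1
    exact ⟨h2.trans hxm.1, by simp only [PiNat.res_succ] at *; linarith⟩

/-- The real number underlying a point of the Sorgenfrey line. -/
def SorgenfreyLine.toReal (x : SorgenfreyLine) : ℝ := x

theorem SorgenfreyLine.isOpen_preimage_Ico (a b : ℝ) :
    IsOpen (SorgenfreyLine.toReal ⁻¹' Ico a b) :=
  TopologicalSpace.isOpen_generateFrom_of_mem ⟨a, b, rfl⟩

/-- Induction over the generated topology: a point of `[a, b)` can itself serve as the left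
endpoint, and intersections take the smaller right endpoint. -/
theorem SorgenfreyLine.exists_Ico_subset {U : Set SorgenfreyLine} (hU : IsOpen U) :
    ∀ p ∈ U, ∃ b > p.toReal, SorgenfreyLine.toReal ⁻¹' Ico p.toReal b ⊆ U := by
  induction hU with
  | basic s hs =>
    obtain ⟨a, b, rfl⟩ := hs
    exact fun p hp => ⟨b, hp.2, fun x hx => ⟨le_trans hp.1 hx.1, hx.2⟩⟩
  | univ => exact fun p _ => ⟨_, lt_add_one _, subset_univ _⟩
  | inter s t _ _ hs ht =>
    intro p hp
    obtain ⟨b, hb, hbs⟩ := hs p hp.1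
    obtain ⟨c, hc, hct⟩ := ht p hp.2
    exact ⟨min b c, lt_min hb hc, fun x hx =>
      ⟨hbs ⟨hx.1, hx.2.trans_le (min_le_left _ _)⟩, hct ⟨hx.1, hx.2.trans_le (min_le_right _ _)⟩⟩⟩
  | sUnion T _ ih =>
    rintro p ⟨s, hs, hp⟩
    obtain ⟨b, hb, hbs⟩ := ih s hs p hp
    exact ⟨b, hb, hbs.trans (subset_sUnion_of_mem hs)⟩

theorem hasPairCode_sorgenfrey {S : Set SorgenfreyLine} (hS : Sᶜ.Countable) : HasPairCode S := by
  refine hasPairCode_of_countable_compl_range (f := fun x : S => x.1.toReal)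
    (fun x y h => Subtype.ext h) ?_ (fun a b => ?_) fun p U hU => ?_
  · have : range (fun x : S => x.1.toReal) = S := Subtype.range_coe
    rw [this]
    exact hS
  · exact (SorgenfreyLine.isOpen_preimage_Ico a b).preimage continuous_subtype_val
  · obtain ⟨V, hV, hVU⟩ := mem_nhds_subtype _ _ _ |>.1 hU
    obtain ⟨W, hWV, hW, hpW⟩ := mem_nhds_iff.1 hV
    obtain ⟨b, hb, hbW⟩ := SorgenfreyLine.exists_Ico_subset hW p.1 hpW
    exact ⟨b, hb, fun x hx => hVU (hWV (hbW hx))⟩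

end PiTree

theorem mainTheorem3 {A : Type*} [Nonempty A] [Countable A]
    (X : A → Type*) [∀ α, TopologicalSpace (X α)]
    (hX : ∀ α, Nonempty (X α ≃ₜ (ℕ → ℕ)) ∨
      ∃ S : Set PiTree.SorgenfreyLine, Sᶜ.Countable ∧ Nonempty (X α ≃ₜ S)) :
    PiTree.HasPiTree (∀ α, X α) := by
  refine (PiTree.HasPairCode.pi fun α => ?_).hasPiTree
  rcases hX α with ⟨⟨h⟩⟩ | ⟨S, hS, ⟨h⟩⟩
  · exact PiTree.hasPairCode_baire.of_homeomorph h
  · exact (PiTree.hasPairCode_sorgenfrey hS).of_homeomorph h
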